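/- Let $\Lambda=\langle|\Lambda|,<\rangle$ be a linear order. Let $\mathcal L_\Lambda$ be the set of formulas built from countably many propositional variables $p_0,p_1,\dots$ and the constant $\top$ by $\neg$, $\wedge$ and a unary modality $[\alpha]$ for each $\alpha\in|\Lambda|$; write $\phi\to\psi$ for $\neg(\phi\wedge\neg\psi)$ and $\langle\alpha\rangle\phi$ for $\neg[\alpha]\neg\phi$. Let $\mathsf{GLP}_\Lambda$ be the least set of formulas of $\mathcal L_\Lambda$ that contains all substitution instances of propositional tautologies and, for all $\alpha,\beta\in|\Lambda|$ and $\chi,\psi\in\mathcal L_\Lambda$, the axioms - $[\alpha](\chi\to\psi)\to([\alpha]\chi\to[\alpha]\psi)$, - $[\alpha]([\alpha]\chi\to\chi)\to[\alpha]\chi$, - $[\alpha]\chi\to[\beta][\alpha]\chi$ for $\alpha\le\beta$, - $\langle\alpha\rangle\chi\to[\beta]\langle\alpha\rangle\chi$ for $\alpha<\beta$, - $[\alpha]\chi\to[\beta]\chi$ for $\alpha\le\beta$, and is closed under modus ponens and under necessitation (from $\chi$ infer $[\alpha]\chi$, for each $\alpha\in|\Lambda|$). Suppose that $\Lambda$ has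 a recursive presentation, that is, an injection $c:|\Lambda|\to\mathbb N$ such that the set $c(|\Lambda|)$ and the relation $\{(c(\alpha),c(\beta)):\alpha<\beta\}$ are computable. Then $\mathsf{GLP}_\Lambda$ is decidable: for every such $c$, the set of Gödel numbers of the formulas in $\mathsf{GLP}_\Lambda$ is a computable subset of $\mathbb N$. Here the Gödel number $\ulcorner\phi\urcorner$ of a formula is defined, with a fixed computable pairing bijection $\mathbb N\times\mathbb N\to\mathbb N$, $(x,y)\mapsto\langle x,y\rangle$, by $\ulcorner p_n\urcorner=\langle 0,n\rangle$, $\ulcorner\top\urcorner=\langle 1,0\rangle$, $\ulcorner\neg\phi\urcorner=\langle 2,\ulcorner\phi\urcorner\rangle$, $\ulcorner\phi\wedge\psi\urcorner=\langle 3,\langle\ulcorner\phi\urcorner,\ulcorner\psi\urcorner\rangle\rangle$ and $\ulcorner[\alpha]\phi\urcorner=\langle 4,\langle c(\alpha),\ulcorner\phi\urcorner\rangle\rangle$. -/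

import Mathlib

namespace GLP

universe u

/-- Purely propositional formulas, built from variables, `⊤`, `¬` and `∧`. -/
inductive PropFormula : Type where
  | var : ℕ → PropFormula
  | top : PropFormula
  | neg : PropFormula → PropFormula
  | and : PropFormula → PropFormula → PropFormula

/-- Truth of a propositional formula under an assignment of truth values to the variables. -/
def PropFormula.Holds (v : ℕ → Prop) : PropFormula → Prop
  | .var n => v n
  | .top => True
  | .neg τ => ¬ τ.Holds v
  | .and τ ρ => τ.Holds v ∧ ρ.Holds v

/-- A propositional tautology: true under every assignment. -/
def PropFormula.IsTautology (τ : PropFormula) : Prop := ∀ v : ℕ → Prop, τ.Holds v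

/-- The full language over `Λ`: propositional variables (indexed by `ℕ`), `⊤`, `¬`, `∧`, and a
unary modality `[α]` for every `α : Λ`. -/
inductive Formula (Λ : Type u) : Type u where
  | var : ℕ → Formula Λ
  | top : Formula Λ
  | neg : Formula Λ → Formula Λ
  | and : Formula Λ → Formula Λ → Formula Λ
  | box : Λ → Formula Λ → Formula Λ

/-- Material implication `φ → ψ`, as `¬(φ ∧ ¬ψ)`. -/
def Formula.imp {Λ : Type u} (φ ψ : Formula Λ) : Formula Λ := .neg (.and φ (.neg ψ))

/-- `⟨α⟩φ`, as `¬[α]¬φ`. -/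
def Formula.dia {Λ : Type u} (α : Λ) (φ : Formula Λ) : Formula Λ := .neg (.box α (.neg φ))

/-- Substitution of modal formulas for the variables of a propositional formula. -/
def PropFormula.subst {Λ : Type u} (σ : ℕ → Formula Λ) : PropFormula → Formula Λ
  | .var n => σ n
  | .top => .top
  | .neg τ => .neg (τ.subst σ)
  | .and τ ρ => .and (τ.subst σ) (ρ.subst σ)

/-- Derivability in the logic `GLP_Λ`. -/
inductive Provable {Λ : Type u} [LinearOrder Λ] : Formula Λ → Prop where
  | taut (τ : PropFormula) (σ : ℕ → Formula Λ) (h : τ.IsTautology) : Provable (τ.subst σ)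
  | distr (α : Λ) (χ ψ : Formula Λ) :
      Provable ((Formula.box α (χ.imp ψ)).imp ((Formula.box α χ).imp (Formula.box α ψ)))
  | loeb (α : Λ) (χ : Formula Λ) :
      Provable ((Formula.box α ((Formula.box α χ).imp χ)).imp (Formula.box α χ))
  | four (α β : Λ) (χ : Formula Λ) (h : α ≤ β) :
      Provable ((Formula.box α χ).imp (Formula.box β (Formula.box α χ)))
  | negIntro (α β : Λ) (χ : Formula Λ) (h : α < β) :
      Provable ((Formula.dia α χ).imp (Formula.box β (Formula.dia α χ)))
  | mono (α β : Λ) (χ : Formula Λ) (h : α ≤ β) :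
      Provable ((Formula.box α χ).imp (Formula.box β χ))
  | mp (χ ψ : Formula Λ) (h₁ : Provable (χ.imp ψ)) (h₂ : Provable χ) : Provable ψ
  | nec (α : Λ) (χ : Formula Λ) (h : Provable χ) : Provable (Formula.box α χ)

/-- A recursive presentation of the linear order `Λ`: an isomorphism of `Λ` with a linear order
whose domain is a computable set of natural numbers and whose order relation is computable. -/
structure RecursivePresentation (Λ : Type u) [LinearOrder Λ] where
  /-- The natural number that names an element of `Λ`. -/
  code : Λ → ℕ
  code_injective : Function.Injective code
  computable_domain : ComputablePred fun n : ℕ => ∃ α : Λ, code α = n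
  computable_lt :
    ComputablePred fun p : ℕ × ℕ => ∃ α β : Λ, code α = p.1 ∧ code β = p.2 ∧ α < β

/-- The Gödel number of a formula, given numbers `c α` for the modals `α`. -/
def Formula.godelNumber {Λ : Type u} (c : Λ → ℕ) : Formula Λ → ℕ
  | .var n => Nat.pair 0 n
  | .top => Nat.pair 1 0
  | .neg φ => Nat.pair 2 (φ.godelNumber c)
  | .and φ ψ => Nat.pair 3 (Nat.pair (φ.godelNumber c) (ψ.godelNumber c))
  | .box α φ => Nat.pair 4 (Nat.pair (c α) (φ.godelNumber c))

/-- Distinct formulas have distinct Gödel numbers. -/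
theorem Formula.godelNumber_injective {Λ : Type u} {c : Λ → ℕ} (hc : Function.Injective c) :
    Function.Injective (Formula.godelNumber c) := by
  intro φ
  induction φ with
  | var n => intro ψ h; cases ψ <;> simp_all [Formula.godelNumber, Nat.pair_eq_pair]
  | top => intro ψ h; cases ψ <;> simp_all [Formula.godelNumber, Nat.pair_eq_pair]
  | neg φ ih =>
    intro ψ h
    cases ψ <;> simp [Formula.godelNumber, Nat.pair_eq_pair] at h ⊢
    exact ih h
  | and φ₁ φ₂ ih₁ ih₂ =>
    intro ψ h
    cases ψ <;> simp [Formula.godelNumber, Nat.pair_eq_pair] at h ⊢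
    exact ⟨ih₁ h.1, ih₂ h.2⟩
  | box α φ ih =>
    intro ψ h
    cases ψ <;> simp [Formula.godelNumber, Nat.pair_eq_pair] at h ⊢
    exact ⟨hc h.1, ih h.2⟩

end GLP

/-! ### Types over a set of formulas -/

namespace GLP

universe u

variable {Λ : Type u}

/-! Decidability comes from a finite syntactic criterion. A type over a subformula-closed set `Δ` is
a subset of `Δ` respecting the connectives. A set `T` of types is `Saturated` if each `[a]φ` of `Δ`
missing from a type `x` of `T` has a witness `y` in `T`: one that is `Reach`-accessible from `x`,
contains `[a]φ` and omits `φ`. For finite `Δ` and `φ ∈ Δ`, `not_provable_iff` states that `φ` is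
unprovable iff some type of some saturated set over `Δ` omits `φ`. As `Δ` has finitely many subsets,
this is a finite search.

Completeness is the canonical construction: the maximal consistent sets are saturated over all
formulas (`saturated_worlds`), and saturation survives intersection with `Δ`.

Soundness is the harder half, since a derivation of `φ` may use formulas outside `Δ`. It uses only
finitely many, and if `Δ` contains them all, each rule is checked directly. It therefore suffices to
enlarge `Δ` one formula at a time, keeping a counterpart of every old type. The only delicate case
is a new boxed formula (`Saturated.exists_insert_box`).

For computability, formulas, types and sets of types become numbers, lists and lists of lists. The
search on a formula with number `n` needs the order only on names up to `n`; given this finite table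
it is primitive recursive, and the table itself is computable from the presentation. -/

theorem subst_mem_iff_holds {Δ x : Set (Formula Λ)}
    (hΔn : ∀ φ, Formula.neg φ ∈ Δ → φ ∈ Δ)
    (hΔa : ∀ φ ψ, Formula.and φ ψ ∈ Δ → φ ∈ Δ ∧ ψ ∈ Δ)
    (ht : Formula.top ∈ Δ → Formula.top ∈ x)
    (hn : ∀ φ, Formula.neg φ ∈ Δ → (Formula.neg φ ∈ x ↔ φ ∉ x))
    (ha : ∀ φ ψ, Formula.and φ ψ ∈ Δ → (Formula.and φ ψ ∈ x ↔ φ ∈ x ∧ ψ ∈ x))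
    (σ : ℕ → Formula Λ) (τ : PropFormula) (hτ : τ.subst σ ∈ Δ) :
    τ.subst σ ∈ x ↔ τ.Holds fun n => σ n ∈ x := by
  induction τ with
  | var n => rfl
  | top => exact iff_of_true (ht hτ) trivial
  | neg τ ih => exact (hn _ hτ).trans (not_congr (ih (hΔn _ hτ)))
  | and τ ρ ih₁ ih₂ =>
    exact (ha _ _ hτ).trans (and_congr (ih₁ (hΔa _ _ hτ).1) (ih₂ (hΔa _ _ hτ).2))

/-- Closure of a set of formulas under immediate subformulas. -/
structure SubformulaClosed (Δ : Set (Formula Λ)) : Prop where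
  neg : ∀ φ, Formula.neg φ ∈ Δ → φ ∈ Δ
  and : ∀ φ ψ, Formula.and φ ψ ∈ Δ → φ ∈ Δ ∧ ψ ∈ Δ
  box : ∀ a φ, Formula.box a φ ∈ Δ → φ ∈ Δ

theorem SubformulaClosed.imp {Δ : Set (Formula Λ)} (hΔ : SubformulaClosed Δ) {φ ψ : Formula Λ}
    (hi : φ.imp ψ ∈ Δ) : φ ∈ Δ ∧ ψ ∈ Δ := by
  have h₁ := hΔ.and _ _ (hΔ.neg _ hi)
  exact ⟨h₁.1, hΔ.neg _ h₁.2⟩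

theorem SubformulaClosed.insert {Δ : Set (Formula Λ)} (hΔ : SubformulaClosed Δ) {χ : Formula Λ}
    (hn : ∀ φ, χ = .neg φ → φ ∈ Δ) (ha : ∀ φ ψ, χ = .and φ ψ → φ ∈ Δ ∧ ψ ∈ Δ)
    (hb : ∀ a φ, χ = .box a φ → φ ∈ Δ) : SubformulaClosed (insert χ Δ) where
  neg φ h := Or.inr (h.elim (fun e => hn φ e.symm) (hΔ.neg φ))
  and φ ψ h := (h.elim (fun e => ha φ ψ e.symm) (hΔ.and φ ψ)).imp Or.inr Or.inr
  box a φ h := Or.inr (h.elim (fun e => hb a φ e.symm) (hΔ.box a φ))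

/-- The type `x`, enlarged by `χ` when `p` holds. -/
def addIf (χ : Formula Λ) (x : Set (Formula Λ)) (p : Prop) : Set (Formula Λ) :=
  {φ | φ ∈ x ∨ φ = χ ∧ p}

theorem mem_addIf_of_ne {χ φ : Formula Λ} {x : Set (Formula Λ)} {p : Prop} (h : φ ≠ χ) :
    φ ∈ addIf χ x p ↔ φ ∈ x := by simp [addIf, h]

theorem mem_addIf_of_mem {Δ : Set (Formula Λ)} {χ φ : Formula Λ} {x : Set (Formula Λ)} {p : Prop}
    (hχ : χ ∉ Δ) (h : φ ∈ Δ) : φ ∈ addIf χ x p ↔ φ ∈ x :=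
  mem_addIf_of_ne (fun e => hχ (e ▸ h))

theorem mem_addIf_self {Δ : Set (Formula Λ)} {χ : Formula Λ} {x : Set (Formula Λ)} {p : Prop}
    (hχ : χ ∉ Δ) (hx : x ⊆ Δ) : χ ∈ addIf χ x p ↔ p := by
  simp only [addIf, Set.mem_ofPred_eq, true_and, or_iff_right_iff_imp]
  exact fun h => (hχ (hx h)).elim

/-- Every type of `T` has a counterpart in `T'` with the same members in `Δ`. -/
def Extends (Δ : Set (Formula Λ)) (T T' : Set (Set (Formula Λ))) : Prop :=
  ∀ x ∈ T, ∃ x' ∈ T', ∀ φ ∈ Δ, φ ∈ x' ↔ φ ∈ x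

theorem Extends.refl (Δ : Set (Formula Λ)) (T : Set (Set (Formula Λ))) : Extends Δ T T :=
  fun x hx => ⟨x, hx, fun _ _ => Iff.rfl⟩

theorem Extends.trans {Δ Δ' : Set (Formula Λ)} {T₁ T₂ T₃ : Set (Set (Formula Λ))}
    (h₁ : Extends Δ T₁ T₂) (hs : Δ ⊆ Δ') (h₂ : Extends Δ' T₂ T₃) : Extends Δ T₁ T₃ := fun x hx => by
  obtain ⟨y, hy, hxy⟩ := h₁ x hx
  obtain ⟨z, hz, hyz⟩ := h₂ y hy
  exact ⟨z, hz, fun φ hφ => (hyz φ (hs hφ)).trans (hxy φ hφ)⟩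

/-! ### Saturated sets and soundness over large sets of formulas -/

section Order

variable [LinearOrder Λ]

/-- The syntactic accessibility relation between types for the modality `a`. -/
def Reach (a : Λ) (x y : Set (Formula Λ)) : Prop :=
  (∀ b φ, b ≤ a → Formula.box b φ ∈ x → φ ∈ y ∧ Formula.box b φ ∈ y) ∧
    ∀ b φ, b < a → Formula.box b φ ∈ y → Formula.box b φ ∈ x

/-- A set `T` of types over `Δ`, coherent for the connectives, in which each failure of a boxed
formula is witnessed. -/
structure Saturated (Δ : Set (Formula Λ)) (T : Set (Set (Formula Λ))) : Prop where
  subset : ∀ x ∈ T, x ⊆ Δ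
  top : ∀ x ∈ T, Formula.top ∈ Δ → Formula.top ∈ x
  neg : ∀ x ∈ T, ∀ φ, Formula.neg φ ∈ Δ → (Formula.neg φ ∈ x ↔ φ ∉ x)
  and : ∀ x ∈ T, ∀ φ ψ, Formula.and φ ψ ∈ Δ → (Formula.and φ ψ ∈ x ↔ φ ∈ x ∧ ψ ∈ x)
  box : ∀ x ∈ T, ∀ a φ, Formula.box a φ ∈ Δ → Formula.box a φ ∉ x →
    ∃ y ∈ T, Reach a x y ∧ Formula.box a φ ∈ y ∧ φ ∉ y

namespace Saturated

variable {Δ : Set (Formula Λ)} {T : Set (Set (Formula Λ))}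

theorem mem_imp_iff (h : Saturated Δ T) (hΔ : SubformulaClosed Δ) {x : Set (Formula Λ)}
    (hx : x ∈ T) {φ ψ : Formula Λ} (hi : φ.imp ψ ∈ Δ) :
    φ.imp ψ ∈ x ↔ (φ ∈ x → ψ ∈ x) := by
  have h₁ := hΔ.neg _ hi
  have h₂ := (hΔ.and _ _ h₁).2
  unfold Formula.imp
  rw [h.neg x hx _ hi, h.and x hx _ _ h₁, h.neg x hx _ h₂]
  tauto

end Saturated

/-- A derivation involves only finitely many formulas; its conclusion belongs to every type of
every saturated set over a set containing these formulas. -/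
theorem Provable.exists_finite_forall_saturated {φ : Formula Λ} (h : Provable φ) :
    ∃ F : Set (Formula Λ), F.Finite ∧ φ ∈ F ∧ ∀ Δ T, SubformulaClosed Δ → Saturated Δ T →
      F ⊆ Δ → ∀ x ∈ T, φ ∈ x := by
  induction h with
  | taut τ σ h =>
    refine ⟨{τ.subst σ}, Set.finite_singleton _, rfl, fun Δ T hΔ hT hF x hx => ?_⟩
    exact (subst_mem_iff_holds hΔ.neg hΔ.and (hT.top x hx) (hT.neg x hx) (hT.and x hx) σ τ
      (hF rfl)).2 (h _)
  | distr α χ ψ =>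
    refine ⟨{_}, Set.finite_singleton _, rfl, fun Δ T hΔ hT hF x hx => ?_⟩
    have h₀ := hF rfl
    have h₁ := hΔ.imp h₀
    have h₂ := hΔ.imp h₁.2
    rw [hT.mem_imp_iff hΔ hx h₀, hT.mem_imp_iff hΔ hx h₁.2]
    intro h₃ h₄
    by_contra h₅
    obtain ⟨y, hy, hr, -, hn⟩ := hT.box x hx _ _ h₂.2 h₅
    exact hn ((hT.mem_imp_iff hΔ hy (hΔ.box _ _ h₁.1)).1 (hr.1 _ _ le_rfl h₃).1
      (hr.1 _ _ le_rfl h₄).1)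
  | loeb α χ =>
    refine ⟨{_}, Set.finite_singleton _, rfl, fun Δ T hΔ hT hF x hx => ?_⟩
    have h₀ := hF rfl
    have h₁ := hΔ.imp h₀
    rw [hT.mem_imp_iff hΔ hx h₀]
    intro h₃
    by_contra h₅
    obtain ⟨y, hy, hr, hb, hn⟩ := hT.box x hx _ _ h₁.2 h₅
    -- The witness contains `[α]χ` itself, so `[α]χ → χ` at `y` yields the omitted `χ`; this is why
    -- saturation asks for that membership.
    exact hn ((hT.mem_imp_iff hΔ hy (hΔ.box _ _ h₁.1)).1 (hr.1 _ _ le_rfl h₃).1 hb)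
  | four α β χ hle =>
    refine ⟨{_}, Set.finite_singleton _, rfl, fun Δ T hΔ hT hF x hx => ?_⟩
    have h₀ := hF rfl
    rw [hT.mem_imp_iff hΔ hx h₀]
    intro h₃
    by_contra h₅
    obtain ⟨y, hy, hr, -, hn⟩ := hT.box x hx _ _ (hΔ.imp h₀).2 h₅
    exact hn (hr.1 _ _ hle h₃).2
  | negIntro α β χ hlt =>
    refine ⟨{_}, Set.finite_singleton _, rfl, fun Δ T hΔ hT hF x hx => ?_⟩
    have h₀ := hF rfl
    have h₁ := (hΔ.imp h₀).1
    rw [hT.mem_imp_iff hΔ hx h₀]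
    intro h₃
    by_contra h₅
    obtain ⟨y, hy, hr, -, hn⟩ := hT.box x hx _ _ (hΔ.imp h₀).2 h₅
    unfold Formula.dia at h₁ h₃ hn
    rw [hT.neg y hy _ h₁, not_not] at hn
    exact (hT.neg x hx _ h₁).1 h₃ (hr.2 _ _ hlt hn)
  | mono α β χ hle =>
    refine ⟨{_}, Set.finite_singleton _, rfl, fun Δ T hΔ hT hF x hx => ?_⟩
    have h₀ := hF rfl
    rw [hT.mem_imp_iff hΔ hx h₀]
    intro h₃
    by_contra h₅
    obtain ⟨y, hy, hr, -, hn⟩ := hT.box x hx _ _ (hΔ.imp h₀).2 h₅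
    exact hn (hr.1 _ _ hle h₃).1
  | mp χ ψ h₁ h₂ ih₁ ih₂ =>
    obtain ⟨F₁, hf₁, hm₁, H₁⟩ := ih₁
    obtain ⟨F₂, hf₂, hm₂, H₂⟩ := ih₂
    refine ⟨insert ψ (F₁ ∪ F₂), (hf₁.union hf₂).insert _, Set.mem_insert _ _,
      fun Δ T hΔ hT hF x hx => ?_⟩
    have hF₁ : F₁ ⊆ Δ := fun _ h => hF (Or.inr (Or.inl h))
    have hF₂ : F₂ ⊆ Δ := fun _ h => hF (Or.inr (Or.inr h))
    exact (hT.mem_imp_iff hΔ hx (hF₁ hm₁)).1 (H₁ Δ T hΔ hT hF₁ x hx) (H₂ Δ T hΔ hT hF₂ x hx)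
  | nec α χ h ih =>
    obtain ⟨F, hf, hm, H⟩ := ih
    refine ⟨insert (.box α χ) F, hf.insert _, Set.mem_insert _ _,
      fun Δ T hΔ hT hF x hx => ?_⟩
    by_contra h₅
    obtain ⟨y, hy, -, -, hn⟩ := hT.box x hx _ _ (hF (Set.mem_insert _ _)) h₅
    exact hn (H Δ T hΔ hT (fun _ h => hF (Or.inr h)) y hy)

/-! ### Strict accessibility and the extension of saturated sets -/

theorem Reach.trans {a b : Λ} {x y z : Set (Formula Λ)} (h₁ : Reach a x y) (h₂ : Reach b y z) :
    Reach (min a b) x z := by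
  refine ⟨fun c φ hc hx => h₂.1 c φ (hc.trans (min_le_right _ _))
    (h₁.1 c φ (hc.trans (min_le_left _ _)) hx).2, fun c φ hc hz => ?_⟩
  exact h₁.2 c φ (hc.trans_le (min_le_left _ _)) (h₂.2 c φ (hc.trans_le (min_le_right _ _)) hz)

/-- `y` is strictly accessible from `x` for some modality that is at least `m`. -/
def StrictReachFrom (m : Λ) (x y : Set (Formula Λ)) : Prop :=
  ∃ n, m ≤ n ∧ Reach n x y ∧ ∃ φ, Formula.box n φ ∈ y ∧ Formula.box n φ ∉ x

theorem StrictReachFrom.irrefl (m : Λ) (x : Set (Formula Λ)) : ¬ StrictReachFrom m x x :=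
  fun ⟨_, _, _, _, h, h'⟩ => h' h

/-- The modality of the composite is the smaller of the two. A box gained in the first step persists
to `z` if its modality is the smaller one; a box gained in the second cannot already be in `x`,
since the first step would have passed it on to `y`. -/
theorem StrictReachFrom.trans {m : Λ} {x y z : Set (Formula Λ)} (h₁ : StrictReachFrom m x y)
    (h₂ : StrictReachFrom m y z) : StrictReachFrom m x z := by
  obtain ⟨a, ha, hxy, φ, hφ, hφ'⟩ := h₁
  obtain ⟨b, hb, hyz, ψ, hψ, hψ'⟩ := h₂
  refine ⟨min a b, le_min ha hb, hxy.trans hyz, ?_⟩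
  rcases le_or_gt a b with hab | hab
  · rw [min_eq_left hab]
    exact ⟨φ, (hyz.1 _ _ hab hφ).2, hφ'⟩
  · rw [min_eq_right hab.le]
    exact ⟨ψ, hψ, fun h => hψ' (hxy.1 _ _ hab.le h).2⟩

/-- In a finite set of types, a failure of `ψ` strictly accessible from `x` can be taken to have
no further failure of `ψ` accessible from it. -/
theorem exists_last_failure {T : Set (Set (Formula Λ))} (hT : T.Finite) (m : Λ) (ψ : Formula Λ)
    {x : Set (Formula Λ)} (h : ∃ y ∈ T, StrictReachFrom m x y ∧ ψ ∉ y) :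
    ∃ y ∈ T, StrictReachFrom m x y ∧ ψ ∉ y ∧ ∀ z ∈ T, StrictReachFrom m y z → ψ ∈ z := by
  obtain ⟨y, hy, hxy, hψ⟩ := h
  have : IsStrictOrder (Set (Formula Λ)) (flip (StrictReachFrom m)) :=
    { irrefl := fun x => StrictReachFrom.irrefl m x
      trans := fun _ _ _ h₁ h₂ => h₂.trans h₁ }
  have wf : T.WellFoundedOn (flip (StrictReachFrom m)) := hT.wellFoundedOn
  revert hxy hψ
  refine wf.induction hy (P := fun y => StrictReachFrom m x y → ψ ∉ y → _) ?_
  intro y hy ih hxy hψ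
  by_cases hz : ∀ z ∈ T, StrictReachFrom m y z → ψ ∈ z
  · exact ⟨y, hy, hxy, hψ, hz⟩
  · push Not at hz
    obtain ⟨z, hzT, hyz, hzψ⟩ := hz
    exact ih z hzT hyz (hxy.trans hyz) hzψ

/-- Accessibility mentions boxed formulas only, apart from the positive transfer of their bodies, so
the old witnesses survive. The predicate `p` gives the truth value of `χ`; it is forced by the
components, and free for a variable. -/
theorem Saturated.exists_insert_of_not_box {Δ : Set (Formula Λ)} {T : Set (Set (Formula Λ))}
    (hΔ : SubformulaClosed Δ) (hT : Saturated Δ T) {χ : Formula Λ} (hχ : χ ∉ Δ)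
    (hb : ∀ a φ, χ ≠ .box a φ)
    (p : Set (Formula Λ) → Prop) (htop : χ = .top → ∀ x, p x)
    (hneg : ∀ φ, χ = .neg φ → ∀ x, p x ↔ φ ∉ x)
    (hand : ∀ φ ψ, χ = .and φ ψ → ∀ x, p x ↔ φ ∈ x ∧ ψ ∈ x)
    (hsn : ∀ φ, χ = .neg φ → φ ∈ Δ) (hsa : ∀ φ ψ, χ = .and φ ψ → φ ∈ Δ ∧ ψ ∈ Δ) :
    ∃ T', Saturated (insert χ Δ) T' ∧ Extends Δ T T' := by
  have hbx : ∀ x a φ, Formula.box a φ ∈ addIf χ x (p x) ↔ Formula.box a φ ∈ x :=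
    fun x a φ => mem_addIf_of_ne (hb a φ).symm
  refine ⟨(fun x => addIf χ x (p x)) '' T, ⟨?_, ?_, ?_, ?_, ?_⟩, fun x hx =>
    ⟨_, ⟨x, hx, rfl⟩, fun φ hφ => mem_addIf_of_mem hχ hφ⟩⟩
  · rintro _ ⟨x, hx, rfl⟩ φ (h | h)
    · exact Or.inr (hT.subset x hx h)
    · exact Or.inl h.1
  · rintro _ ⟨x, hx, rfl⟩ (h | h)
    · exact Or.inr ⟨h, htop h.symm x⟩
    · exact Or.inl (hT.top x hx h)
  · rintro _ ⟨x, hx, rfl⟩ φ (h | h)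
    · dsimp only
      rw [mem_addIf_of_mem hχ (hsn φ h.symm), h, mem_addIf_self hχ (hT.subset x hx)]
      exact hneg φ h.symm x
    · dsimp only
      rw [mem_addIf_of_mem hχ h, mem_addIf_of_mem hχ (hΔ.neg _ h)]
      exact hT.neg x hx φ h
  · rintro _ ⟨x, hx, rfl⟩ φ ψ (h | h)
    · dsimp only
      rw [mem_addIf_of_mem hχ (hsa φ ψ h.symm).1, mem_addIf_of_mem hχ (hsa φ ψ h.symm).2,
        h, mem_addIf_self hχ (hT.subset x hx)]
      exact hand φ ψ h.symm x
    · dsimp only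
      rw [mem_addIf_of_mem hχ h, mem_addIf_of_mem hχ (hΔ.and _ _ h).1,
        mem_addIf_of_mem hχ (hΔ.and _ _ h).2]
      exact hT.and x hx φ ψ h
  · rintro _ ⟨x, hx, rfl⟩ a φ (h | h) hn
    · exact (hb a φ h.symm).elim
    · dsimp only at hn
      rw [hbx] at hn
      obtain ⟨y, hy, hr, h₁, h₂⟩ := hT.box x hx a φ h hn
      refine ⟨_, ⟨y, hy, rfl⟩, ⟨fun b ψ hba hψ => ?_, fun b ψ hba hψ => ?_⟩, (hbx _ _ _).2 h₁,
        fun h₃ => h₂ ((mem_addIf_of_mem hχ (hΔ.box _ _ h)).1 h₃)⟩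
      · rw [hbx] at hψ
        exact ⟨Or.inl (hr.1 b ψ hba hψ).1, Or.inl (hr.1 b ψ hba hψ).2⟩
      · dsimp only at hψ ⊢
        rw [hbx] at hψ ⊢
        exact hr.2 b ψ hba hψ

/-- The key extension step: a saturated set over `Δ` extends to one that decides a new boxed
formula `[m]ψ` with `ψ ∈ Δ`. -/
theorem Saturated.exists_insert_box {Δ : Set (Formula Λ)} {T : Set (Set (Formula Λ))}
    (hfin : Δ.Finite) (hΔ : SubformulaClosed Δ) (hT : Saturated Δ T) {m : Λ} {ψ : Formula Λ}
    (hχ : Formula.box m ψ ∉ Δ) (hψ : ψ ∈ Δ) :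
    ∃ T', Saturated (insert (.box m ψ) Δ) T' ∧ Extends Δ T T' := by
  have hTfin : T.Finite := hfin.finite_subsets.subset hT.subset
  -- Types that are `good` can receive `[m]ψ`; types that are `bad` can omit it, with a good type as
  -- witness. A type that is both enters `T'` in two copies.
  let good : Set (Formula Λ) → Prop := fun x => ∀ y ∈ T, StrictReachFrom m x y → ψ ∈ y
  let bad : Set (Formula Λ) → Prop := fun x => ∃ y ∈ T, good y ∧ ψ ∉ y ∧ Reach m x y
  let T' : Set (Set (Formula Λ)) :=
    {z | ∃ x ∈ T, (good x ∧ z = addIf (.box m ψ) x True) ∨ (bad x ∧ z = addIf (.box m ψ) x False)}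
  have hself : ∀ x ∈ T, ∀ p, Formula.box m ψ ∈ addIf (.box m ψ) x p ↔ p :=
    fun x hx p => mem_addIf_self hχ (hT.subset x hx)
  have hold : ∀ x p, ∀ φ ∈ Δ, φ ∈ addIf (.box m ψ) x p ↔ φ ∈ x :=
    fun x p φ hφ => mem_addIf_of_mem hχ hφ
  have hex : ∀ x ∈ T, ∃ p, addIf (.box m ψ) x p ∈ T' := by
    intro x hx
    by_cases hg : good x
    · exact ⟨True, x, hx, Or.inl ⟨hg, rfl⟩⟩
    · refine ⟨False, x, hx, Or.inr ⟨?_, rfl⟩⟩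
      have : ∃ y ∈ T, StrictReachFrom m x y ∧ ψ ∉ y := by
        simpa only [good, not_forall, exists_prop] using hg
      -- A last failure of `ψ` is itself good, and accessibility for `n ≥ m` implies accessibility
      -- for `m`; hence a type that is not good is bad.
      obtain ⟨y, hy, ⟨n, hn, hr, -⟩, hyψ, hyg⟩ := exists_last_failure hTfin m ψ this
      exact ⟨y, hy, hyg, hyψ, fun b φ hb hφ => hr.1 b φ (hb.trans hn) hφ,
        fun b φ hb hφ => hr.2 b φ (hb.trans_le hn) hφ⟩
  have hcase : ∀ z ∈ T', ∃ x ∈ T, ∃ p, z = addIf (.box m ψ) x p := by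
    rintro z ⟨x, hx, ⟨-, rfl⟩ | ⟨-, rfl⟩⟩
    exacts [⟨x, hx, _, rfl⟩, ⟨x, hx, _, rfl⟩]
  -- Accessibility lifts as soon as it is respected by the new formula.
  have hlift : ∀ n, ∀ x ∈ T, ∀ y ∈ T, ∀ p q : Prop, Reach n x y → (m ≤ n → p → ψ ∈ y ∧ q) →
      (m < n → q → p) → Reach n (addIf (.box m ψ) x p) (addIf (.box m ψ) y q) := by
    intro n x hx y hy p q hr h₁ h₂
    refine ⟨fun b φ hb hφ => ?_, fun b φ hb hφ => ?_⟩
    · rcases hφ with hφ | ⟨e, hp⟩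
      · exact ⟨Or.inl (hr.1 b φ hb hφ).1, Or.inl (hr.1 b φ hb hφ).2⟩
      · obtain ⟨rfl, rfl⟩ := Formula.box.inj e
        exact ⟨Or.inl (h₁ hb hp).1, Or.inr ⟨rfl, (h₁ hb hp).2⟩⟩
    · rcases hφ with hφ | ⟨e, hp⟩
      · exact Or.inl (hr.2 b φ hb hφ)
      · obtain ⟨rfl, rfl⟩ := Formula.box.inj e
        exact Or.inr ⟨rfl, h₂ hb hp⟩
  refine ⟨T', ⟨?_, ?_, ?_, ?_, ?_⟩, fun x hx => ?_⟩
  · intro z hz φ hφ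
    obtain ⟨x, hx, p, rfl⟩ := hcase z hz
    rcases hφ with h | h
    · exact Or.inr (hT.subset x hx h)
    · exact Or.inl h.1
  · intro z hz h
    obtain ⟨x, hx, p, rfl⟩ := hcase z hz
    rcases h with h | h
    · cases h
    · exact Or.inl (hT.top x hx h)
  · intro z hz φ h
    obtain ⟨x, hx, p, rfl⟩ := hcase z hz
    rcases h with h | h
    · cases h
    · rw [hold _ _ _ h, hold _ _ _ (hΔ.neg _ h)]
      exact hT.neg x hx φ h
  · intro z hz φ χ h
    obtain ⟨x, hx, p, rfl⟩ := hcase z hz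
    rcases h with h | h
    · cases h
    · rw [hold _ _ _ h, hold _ _ _ (hΔ.and _ _ h).1, hold _ _ _ (hΔ.and _ _ h).2]
      exact hT.and x hx φ χ h
  · rintro z ⟨x, hx, ⟨hg, rfl⟩ | ⟨⟨w, hw, hwg, hwψ, hxw⟩, rfl⟩⟩ n φ h hn
    · rcases h with h | h
      · exact (hn (h ▸ (hself x hx _).2 trivial)).elim
      · rw [hold _ _ _ h] at hn
        obtain ⟨y, hy, hr, h₁, h₂⟩ := hT.box x hx n φ h hn
        have hφ := hΔ.box _ _ h
        -- If `m ≤ n`, the old witness `y` is strictly accessible: it contains the missing `[n]φ`.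
        -- So it satisfies `ψ` and inherits goodness. If `n < m`, accessibility for `n` does not
        -- constrain `[m]ψ`, and either copy serves.
        rcases le_or_gt m n with hmn | hmn
        · have hxy : StrictReachFrom m x y := ⟨n, hmn, hr, φ, h₁, hn⟩
          refine ⟨_, ⟨y, hy, Or.inl ⟨fun z hz hyz => hg z hz (hxy.trans hyz), rfl⟩⟩,
            hlift n x hx y hy _ _ hr (fun _ _ => ⟨hg y hy hxy, trivial⟩) (fun _ _ => trivial),
            (hold _ _ _ h).2 h₁, fun h' => h₂ ((hold _ _ _ hφ).1 h')⟩
        · obtain ⟨p, hp⟩ := hex y hy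
          exact ⟨_, hp, hlift n x hx y hy _ _ hr (fun h' => (hmn.not_ge h').elim)
            (fun _ _ => trivial), (hold _ _ _ h).2 h₁, fun h' => h₂ ((hold _ _ _ hφ).1 h')⟩
    · rcases h with h | h
      · obtain ⟨rfl, rfl⟩ := Formula.box.inj h
        -- For the new box, the witness is the good copy of `w`: it contains `[m]ψ` and omits `ψ`.
        exact ⟨_, ⟨w, hw, Or.inl ⟨hwg, rfl⟩⟩, hlift n x hx w hw _ _ hxw
          (fun _ h' => h'.elim) (fun h' => (lt_irrefl _ h').elim), (hself w hw _).2 trivial,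
          fun h' => hwψ ((hold _ _ _ hψ).1 h')⟩
      · rw [hold _ _ _ h] at hn
        obtain ⟨y, hy, hr, h₁, h₂⟩ := hT.box x hx n φ h hn
        have hφ := hΔ.box _ _ h
        rcases lt_or_ge m n with hmn | hmn
        -- For `m < n`, the copy of `y` must omit `[m]ψ`. It is bad by the same `w`: `x` and `y`
        -- agree on the boxes of `Δ` with modality below `n`, so `y` reaches `w` for `m` as `x`
        -- does.
        · refine ⟨_, ⟨y, hy, Or.inr ⟨⟨w, hw, hwg, hwψ, fun b χ hb hχ' => ?_, fun b χ hb hχ' => ?_⟩,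
            rfl⟩⟩, hlift n x hx y hy _ _ hr (fun _ h' => h'.elim) (fun _ h' => h'),
            (hold _ _ _ h).2 h₁, fun h' => h₂ ((hold _ _ _ hφ).1 h')⟩
          · exact hxw.1 b χ hb (hr.2 b χ (hb.trans_lt hmn) hχ')
          · exact (hr.1 b χ (hb.le.trans hmn.le) (hxw.2 b χ hb hχ')).2
        · obtain ⟨p, hp⟩ := hex y hy
          exact ⟨_, hp, hlift n x hx y hy _ _ hr (fun _ h' => h'.elim)
            (fun h' => (hmn.not_gt h').elim), (hold _ _ _ h).2 h₁,
            fun h' => h₂ ((hold _ _ _ hφ).1 h')⟩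
  · obtain ⟨p, hp⟩ := hex x hx
    exact ⟨_, hp, fun φ hφ => hold _ _ _ hφ⟩

/-- Any saturated set over a finite set of formulas extends to one over a finite set that
contains a given formula. -/
theorem Saturated.exists_extends_mem (χ : Formula Λ) {Δ : Set (Formula Λ)}
    {T : Set (Set (Formula Λ))} (hfin : Δ.Finite) (hΔ : SubformulaClosed Δ)
    (hT : Saturated Δ T) :
    ∃ Δ' T', Δ'.Finite ∧ SubformulaClosed Δ' ∧ Saturated Δ' T' ∧ Δ ⊆ Δ' ∧ χ ∈ Δ' ∧
      Extends Δ T T' := by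
  induction χ generalizing Δ T with
  | var n =>
    by_cases hχ : Formula.var n ∈ Δ
    · exact ⟨Δ, T, hfin, hΔ, hT, subset_rfl, hχ, .refl Δ T⟩
    obtain ⟨T', h₁, h₂⟩ := hT.exists_insert_of_not_box hΔ hχ (by simp) (fun _ => True)
      (by simp) (by simp) (by simp) (by simp) (by simp)
    exact ⟨_, T', hfin.insert _, hΔ.insert (by simp) (by simp) (by simp), h₁,
      Set.subset_insert _ _, Set.mem_insert _ _, h₂⟩
  | top =>
    by_cases hχ : Formula.top ∈ Δ
    · exact ⟨Δ, T, hfin, hΔ, hT, subset_rfl, hχ, .refl Δ T⟩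
    obtain ⟨T', h₁, h₂⟩ := hT.exists_insert_of_not_box hΔ hχ (by simp) (fun _ => True)
      (by simp) (by simp) (by simp) (by simp) (by simp)
    exact ⟨_, T', hfin.insert _, hΔ.insert (by simp) (by simp) (by simp), h₁,
      Set.subset_insert _ _, Set.mem_insert _ _, h₂⟩
  | neg χ ih =>
    obtain ⟨Δ₁, T₁, hfin₁, hΔ₁, hT₁, hs₁, hm₁, he₁⟩ := ih hfin hΔ hT
    by_cases hχ : Formula.neg χ ∈ Δ₁
    · exact ⟨Δ₁, T₁, hfin₁, hΔ₁, hT₁, hs₁, hχ, he₁⟩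
    obtain ⟨T', h₁, h₂⟩ := hT₁.exists_insert_of_not_box hΔ₁ hχ (by simp) (fun x => χ ∉ x)
      (by simp) (by simp) (by simp) (by simpa using hm₁) (by simp)
    exact ⟨_, T', hfin₁.insert _, hΔ₁.insert (by simpa using hm₁) (by simp) (by simp), h₁,
      hs₁.trans (Set.subset_insert _ _), Set.mem_insert _ _, he₁.trans hs₁ h₂⟩
  | and χ₁ χ₂ ih₁ ih₂ =>
    obtain ⟨Δ₀, T₀, hfin₀, hΔ₀, hT₀, hs₀, hm₀, he₀⟩ := ih₁ hfin hΔ hT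
    obtain ⟨Δ₁, T₁, hfin₁, hΔ₁, hT₁, hs₁, hm₁, he₁⟩ := ih₂ hfin₀ hΔ₀ hT₀
    have he : Extends Δ T T₁ := he₀.trans hs₀ he₁
    have hs : Δ ⊆ Δ₁ := hs₀.trans hs₁
    by_cases hχ : Formula.and χ₁ χ₂ ∈ Δ₁
    · exact ⟨Δ₁, T₁, hfin₁, hΔ₁, hT₁, hs, hχ, he⟩
    have hm : ∀ φ ψ, Formula.and χ₁ χ₂ = .and φ ψ → φ ∈ Δ₁ ∧ ψ ∈ Δ₁ := by
      rintro φ ψ ⟨⟩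
      exact ⟨hs₁ hm₀, hm₁⟩
    obtain ⟨T', h₁, h₂⟩ := hT₁.exists_insert_of_not_box hΔ₁ hχ (by simp)
      (fun x => χ₁ ∈ x ∧ χ₂ ∈ x) (by simp) (by simp) (by rintro φ ψ ⟨⟩; simp) (by simp) hm
    exact ⟨_, T', hfin₁.insert _, hΔ₁.insert (by simp) hm (by simp), h₁,
      hs.trans (Set.subset_insert _ _), Set.mem_insert _ _, he.trans hs h₂⟩
  | box m χ ih =>
    obtain ⟨Δ₁, T₁, hfin₁, hΔ₁, hT₁, hs₁, hm₁, he₁⟩ := ih hfin hΔ hT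
    by_cases hχ : Formula.box m χ ∈ Δ₁
    · exact ⟨Δ₁, T₁, hfin₁, hΔ₁, hT₁, hs₁, hχ, he₁⟩
    obtain ⟨T', h₁, h₂⟩ := hT₁.exists_insert_box hfin₁ hΔ₁ hχ hm₁
    exact ⟨_, T', hfin₁.insert _, hΔ₁.insert (by simp) (by simp) (by rintro a φ ⟨⟩; exact hm₁), h₁,
      hs₁.trans (Set.subset_insert _ _), Set.mem_insert _ _, he₁.trans hs₁ h₂⟩

theorem Saturated.exists_extends {F : Set (Formula Λ)} (hF : F.Finite) {Δ : Set (Formula Λ)}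
    {T : Set (Set (Formula Λ))} (hfin : Δ.Finite) (hΔ : SubformulaClosed Δ)
    (hT : Saturated Δ T) :
    ∃ Δ' T', Δ'.Finite ∧ SubformulaClosed Δ' ∧ Saturated Δ' T' ∧ Δ ⊆ Δ' ∧ F ⊆ Δ' ∧
      Extends Δ T T' := by
  induction F, hF using Set.Finite.induction_on with
  | empty =>
    exact ⟨Δ, T, hfin, hΔ, hT, subset_rfl, Set.empty_subset _, .refl Δ T⟩
  | @insert χ F _ _ ih =>
    obtain ⟨Δ₁, T₁, hfin₁, hΔ₁, hT₁, hs₁, hm₁, he₁⟩ := ih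
    obtain ⟨Δ₂, T₂, hfin₂, hΔ₂, hT₂, hs₂, hm₂, he₂⟩ := hT₁.exists_extends_mem χ hfin₁ hΔ₁
    exact ⟨Δ₂, T₂, hfin₂, hΔ₂, hT₂, hs₁.trans hs₂, Set.insert_subset hm₂ (hm₁.trans hs₂),
      he₁.trans hs₁ he₂⟩

/-- Soundness: theorems belong to all types of a saturated set over a finite set of formulas. -/
theorem Provable.mem_of_saturated {φ : Formula Λ} (h : Provable φ) {Δ : Set (Formula Λ)}
    {T : Set (Set (Formula Λ))} (hfin : Δ.Finite) (hΔ : SubformulaClosed Δ)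
    (hT : Saturated Δ T) (hφ : φ ∈ Δ) {x : Set (Formula Λ)} (hx : x ∈ T) : φ ∈ x := by
  obtain ⟨F, hF, -, H⟩ := h.exists_finite_forall_saturated
  obtain ⟨Δ', T', -, hΔ', hT', -, hs, he⟩ := hT.exists_extends hF hfin hΔ
  obtain ⟨y, hy, hxy⟩ := he x hx
  exact (hxy φ hφ).1 (H Δ' T' hΔ' hT' hs y hy)

/-! ### Maximal consistent sets and completeness -/

/-- Derivability from a set of hypotheses, without necessitation of the hypotheses. -/
inductive Derives (Γ : Set (Formula Λ)) : Formula Λ → Prop where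
  | hyp (φ : Formula Λ) (h : φ ∈ Γ) : Derives Γ φ
  | thm (φ : Formula Λ) (h : Provable φ) : Derives Γ φ
  | mp (φ ψ : Formula Λ) (h₁ : Derives Γ (φ.imp ψ)) (h₂ : Derives Γ φ) : Derives Γ ψ

/-- Assignment of three formulas to the variables of a propositional formula. -/
def subst₃ (φ ψ χ : Formula Λ) : ℕ → Formula Λ
  | 0 => φ
  | 1 => ψ
  | _ => χ

/-- Implication between propositional formulas. -/
def PropFormula.imp (τ ρ : PropFormula) : PropFormula := .neg (.and τ (.neg ρ))

theorem PropFormula.holds_imp (v : ℕ → Prop) (τ ρ : PropFormula) :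
    (τ.imp ρ).Holds v ↔ (τ.Holds v → ρ.Holds v) := by
  simp only [PropFormula.imp, PropFormula.Holds]
  tauto

namespace Provable

theorem imp_weaken (φ ψ : Formula Λ) : Provable (φ.imp (ψ.imp φ)) :=
  taut ((PropFormula.var 0).imp ((PropFormula.var 1).imp (.var 0))) (subst₃ φ ψ φ) fun v => by
    simp only [PropFormula.holds_imp]; tauto

theorem imp_distrib (φ ψ χ : Formula Λ) :
    Provable ((φ.imp (ψ.imp χ)).imp ((φ.imp ψ).imp (φ.imp χ))) :=
  taut (((PropFormula.var 0).imp ((PropFormula.var 1).imp (.var 2))).imp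
    (((PropFormula.var 0).imp (.var 1)).imp ((PropFormula.var 0).imp (.var 2))))
    (subst₃ φ ψ χ) fun v => by
    simp only [PropFormula.holds_imp]; tauto

theorem imp_self (φ : Formula Λ) : Provable (φ.imp φ) :=
  taut ((PropFormula.var 0).imp (.var 0)) (subst₃ φ φ φ) fun v => by
    simp only [PropFormula.holds_imp]; tauto

theorem imp_not_not (φ : Formula Λ) : Provable (φ.imp (.neg (.neg φ))) :=
  taut ((PropFormula.var 0).imp (.neg (.neg (.var 0)))) (subst₃ φ φ φ) fun v => by
    simp only [PropFormula.holds_imp, PropFormula.Holds]; tauto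

theorem not_not_imp (φ : Formula Λ) : Provable ((Formula.neg (.neg φ)).imp φ) :=
  taut ((PropFormula.neg (.neg (.var 0))).imp (.var 0)) (subst₃ φ φ φ) fun v => by
    simp only [PropFormula.holds_imp, PropFormula.Holds]; tauto

theorem by_cases (φ ψ : Formula Λ) :
    Provable ((φ.imp ψ).imp (((Formula.neg φ).imp ψ).imp ψ)) :=
  taut (((PropFormula.var 0).imp (.var 1)).imp
    (((PropFormula.neg (.var 0)).imp (.var 1)).imp (.var 1))) (subst₃ φ ψ φ) fun v => by
    simp only [PropFormula.holds_imp, PropFormula.Holds]; tauto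

theorem absurd (φ ψ : Formula Λ) : Provable ((Formula.neg φ).imp (φ.imp ψ)) :=
  taut ((PropFormula.neg (.var 0)).imp ((PropFormula.var 0).imp (.var 1))) (subst₃ φ ψ φ)
    fun v => by simp only [PropFormula.holds_imp, PropFormula.Holds]; tauto

theorem contrapose (φ ψ : Formula Λ) :
    Provable ((φ.imp ψ).imp ((Formula.neg ψ).imp (.neg φ))) :=
  taut (((PropFormula.var 0).imp (.var 1)).imp
    ((PropFormula.neg (.var 1)).imp (.neg (.var 0)))) (subst₃ φ ψ φ) fun v => by
    simp only [PropFormula.holds_imp, PropFormula.Holds]; tauto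

theorem and_intro (φ ψ : Formula Λ) : Provable (φ.imp (ψ.imp (.and φ ψ))) :=
  taut ((PropFormula.var 0).imp ((PropFormula.var 1).imp (.and (.var 0) (.var 1))))
    (subst₃ φ ψ φ) fun v => by
    simp only [PropFormula.holds_imp, PropFormula.Holds]; tauto

theorem and_left (φ ψ : Formula Λ) : Provable ((Formula.and φ ψ).imp φ) :=
  taut ((PropFormula.and (.var 0) (.var 1)).imp (.var 0)) (subst₃ φ ψ φ) fun v => by
    simp only [PropFormula.holds_imp, PropFormula.Holds]; tauto

theorem and_right (φ ψ : Formula Λ) : Provable ((Formula.and φ ψ).imp ψ) :=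
  taut ((PropFormula.and (.var 0) (.var 1)).imp (.var 1)) (subst₃ φ ψ φ) fun v => by
    simp only [PropFormula.holds_imp, PropFormula.Holds]; tauto

theorem top : Provable (Formula.top : Formula Λ) :=
  taut .top (fun _ => .top) fun _ => trivial

theorem box_imp {φ ψ : Formula Λ} (a : Λ) (h : Provable (φ.imp ψ)) :
    Provable ((Formula.box a φ).imp (.box a ψ)) :=
  mp _ _ (distr a φ ψ) (nec a _ h)

end Provable

namespace Derives

variable {Γ Γ' : Set (Formula Λ)} {φ ψ : Formula Λ}

theorem of_imp (h : Provable (φ.imp ψ)) (h' : Derives Γ φ) : Derives Γ ψ :=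
  mp _ _ (thm _ h) h'

theorem provable_of_empty (h : Derives ∅ φ) : Provable φ := by
  induction h with
  | hyp φ h => exact h.elim
  | thm φ h => exact h
  | mp φ ψ _ _ ih₁ ih₂ => exact Provable.mp _ _ ih₁ ih₂

theorem deduction (h : Derives (insert φ Γ) ψ) : Derives Γ (φ.imp ψ) := by
  induction h with
  | hyp ψ h =>
    rcases h with rfl | h
    · exact thm _ (Provable.imp_self _)
    · exact of_imp (Provable.imp_weaken _ _) (hyp _ h)
  | thm ψ h => exact of_imp (Provable.imp_weaken _ _) (thm _ h)
  | mp χ ψ _ _ ih₁ ih₂ => exact mp _ _ (of_imp (Provable.imp_distrib _ _ _) ih₁) ih₂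

/-- A derivation from a directed union uses hypotheses from one member only. -/
theorem exists_of_sUnion {c : Set (Set (Formula Λ))} (hc : IsChain (· ⊆ ·) c) (hne : c.Nonempty)
    (h : Derives (⋃₀ c) φ) : ∃ Γ ∈ c, Derives Γ φ := by
  have hmono : ∀ Γ Γ' : Set (Formula Λ), Γ ⊆ Γ' → ∀ φ, Derives Γ φ → Derives Γ' φ := by
    intro Γ Γ' hs φ h
    induction h with
    | hyp φ h => exact hyp _ (hs h)
    | thm φ h => exact thm _ h
    | mp _ _ _ _ ih₁ ih₂ => exact mp _ _ ih₁ ih₂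
  induction h with
  | hyp φ h =>
    obtain ⟨Γ, hΓ, hφ⟩ := h
    exact ⟨Γ, hΓ, hyp _ hφ⟩
  | thm φ h => exact ⟨_, hne.some_mem, thm _ h⟩
  | mp φ ψ _ _ ih₁ ih₂ =>
    obtain ⟨Γ₁, hΓ₁, h₁⟩ := ih₁
    obtain ⟨Γ₂, hΓ₂, h₂⟩ := ih₂
    rcases hc.total hΓ₁ hΓ₂ with hs | hs
    · exact ⟨Γ₂, hΓ₂, mp _ _ (hmono _ _ hs _ h₁) h₂⟩
    · exact ⟨Γ₁, hΓ₁, mp _ _ h₁ (hmono _ _ hs _ h₂)⟩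

/-- Distributing the box along the derivation treats infinite sets of hypotheses without forming
conjunctions. -/
theorem box (a : Λ) (h : Derives Γ φ) (hΓ : ∀ ψ ∈ Γ, Derives Γ' (.box a ψ)) :
    Derives Γ' (.box a φ) := by
  induction h with
  | hyp φ h => exact hΓ φ h
  | thm φ h => exact thm _ (Provable.nec a _ h)
  | mp φ ψ _ _ ih₁ ih₂ => exact mp _ _ (of_imp (Provable.distr a φ ψ) ih₁) ih₂

end Derives

/-- Maximal consistent sets of formulas. -/
def worlds (Λ : Type u) [LinearOrder Λ] : Set (Set (Formula Λ)) :=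
  {Γ | (∀ φ, Derives Γ φ → φ ∈ Γ) ∧ ∀ φ, Formula.neg φ ∈ Γ ↔ φ ∉ Γ}

/-- Lindenbaum's lemma. -/
theorem exists_world {Γ : Set (Formula Λ)} {φ : Formula Λ} (h : ¬ Derives Γ φ) :
    ∃ Γ' ∈ worlds Λ, Γ ⊆ Γ' ∧ φ ∉ Γ' := by
  obtain ⟨Γ', hs, hmax⟩ := zorn_subset_nonempty {Γ : Set (Formula Λ) | ¬ Derives Γ φ}
    (fun c hc hch hne => ⟨⋃₀ c, fun hd => by
      obtain ⟨Γ, hΓ, hd⟩ := hd.exists_of_sUnion hch hne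
      exact hc hΓ hd, fun s hs => Set.subset_sUnion_of_mem hs⟩) Γ h
  have hφ : ¬ Derives Γ' φ := hmax.prop
  have hins : ∀ ψ, ψ ∉ Γ' → Derives Γ' (ψ.imp φ) := by
    intro ψ hψ
    by_contra hn
    exact hψ (hmax.le_of_ge (y := insert ψ Γ') (fun hd => hn hd.deduction)
      (Set.subset_insert _ _) (Set.mem_insert _ _))
  refine ⟨Γ', ⟨fun ψ hψ => ?_, fun ψ => ⟨fun h₁ h₂ => ?_, fun h₁ => ?_⟩⟩, hs,
    fun h => hφ (.hyp _ h)⟩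
  · by_contra hn
    exact hφ (.mp _ _ (hins ψ hn) hψ)
  · exact hφ (.mp _ _ (.of_imp (.absurd ψ φ) (.hyp _ h₁)) (.hyp _ h₂))
  · by_contra h₂
    exact hφ (.mp _ _ (.of_imp (.by_cases ψ φ) (hins _ h₁)) (hins _ h₂))

theorem exists_world_not_mem {φ : Formula Λ} (h : ¬ Provable φ) : ∃ Γ ∈ worlds Λ, φ ∉ Γ := by
  obtain ⟨Γ, hΓ, -, hφ⟩ := exists_world (Γ := ∅) (fun hd => h hd.provable_of_empty)
  exact ⟨Γ, hΓ, hφ⟩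

/-- The maximal consistent sets form a saturated set over the set of all formulas. -/
theorem saturated_worlds : Saturated Set.univ (worlds Λ) where
  subset _ _ := Set.subset_univ _
  top _ hx _ := hx.1 _ (.thm _ .top)
  neg _ hx φ _ := hx.2 φ
  and _ hx φ ψ _ := ⟨fun h => ⟨hx.1 _ (.of_imp (.and_left φ ψ) (.hyp _ h)),
    hx.1 _ (.of_imp (.and_right φ ψ) (.hyp _ h))⟩, fun h =>
    hx.1 _ (.mp _ _ (.of_imp (.and_intro φ ψ) (.hyp _ h.1)) (.hyp _ h.2))⟩
  box Γ hΓ a φ _ hφ := by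
    -- `S` collects exactly what accessibility for `a` demands of the witness; the negated boxes
    -- secure the backward clause.
    let S : Set (Formula Λ) := {χ | ∃ b ≤ a, ∃ ψ, Formula.box b ψ ∈ Γ ∧ (χ = ψ ∨ χ = .box b ψ)} ∪
      {χ | ∃ b < a, ∃ ψ, Formula.box b ψ ∉ Γ ∧ χ = .neg (.box b ψ)}
    have hS : ∀ χ ∈ S, Derives Γ (.box a χ) := by
      rintro χ (⟨b, hb, ψ, hψ, rfl | rfl⟩ | ⟨b, hb, ψ, hψ, rfl⟩)
      · exact .of_imp (.mono b a χ hb) (.hyp _ hψ)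
      · exact .of_imp (.four b a ψ hb) (.hyp _ hψ)
      -- `¬[b]ψ` is not literally a diamond: it is passed to `⟨b⟩¬ψ`, which is `¬[b]¬¬ψ`, and back.
      · have h₁ : Formula.dia b (.neg ψ) ∈ Γ := (hΓ.2 _).2 fun h =>
          hψ (hΓ.1 _ (.of_imp (Provable.box_imp b (.not_not_imp ψ)) (.hyp _ h)))
        have h₂ : Provable ((Formula.dia b (.neg ψ)).imp (.neg (.box b ψ))) :=
          .mp _ _ (.contrapose _ _) (Provable.box_imp b (.imp_not_not ψ))
        exact .of_imp (Provable.box_imp a h₂) (.of_imp (.negIntro b a _ hb) (.hyp _ h₁))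
    -- Löb's axiom makes it consistent to add `[a]φ` to the witness while omitting `φ`.
    have hnd : ¬ Derives (insert (.box a φ) S) φ := fun hd =>
      hφ (hΓ.1 _ (.of_imp (.loeb a φ) (hd.deduction.box a hS)))
    obtain ⟨Γ', hΓ', hs, hn⟩ := exists_world hnd
    refine ⟨Γ', hΓ', ⟨fun b ψ hb hψ => ⟨?_, ?_⟩, fun b ψ hb hψ => ?_⟩, hs (Set.mem_insert _ _), hn⟩
    · exact hs (Or.inr (Or.inl ⟨b, hb, ψ, hψ, Or.inl rfl⟩))
    · exact hs (Or.inr (Or.inl ⟨b, hb, ψ, hψ, Or.inr rfl⟩))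
    · by_contra h
      exact (hΓ'.2 _).1 (hs (Or.inr (Or.inr ⟨b, hb, ψ, h, rfl⟩))) hψ

theorem Saturated.restrict {T : Set (Set (Formula Λ))} (hT : Saturated Set.univ T)
    {Δ : Set (Formula Λ)} (hΔ : SubformulaClosed Δ) : Saturated Δ ((· ∩ Δ) '' T) where
  subset := by rintro _ ⟨x, -, rfl⟩; exact Set.inter_subset_right
  top := by rintro _ ⟨x, hx, rfl⟩ h; exact ⟨hT.top x hx trivial, h⟩
  neg := by
    rintro _ ⟨x, hx, rfl⟩ φ h
    simp [h, hΔ.neg _ h, hT.neg x hx φ trivial]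
  and := by
    rintro _ ⟨x, hx, rfl⟩ φ ψ h
    simp [h, hΔ.and _ _ h, hT.and x hx φ ψ trivial]
  box := by
    rintro _ ⟨x, hx, rfl⟩ a φ h hn
    obtain ⟨y, hy, hr, h₁, h₂⟩ := hT.box x hx a φ trivial fun h' => hn ⟨h', h⟩
    refine ⟨_, ⟨y, hy, rfl⟩, ⟨fun b ψ hb hψ => ?_, fun b ψ hb hψ => ?_⟩, ⟨h₁, h⟩,
      fun h' => h₂ h'.1⟩
    · exact ⟨⟨(hr.1 b ψ hb hψ.1).1, hΔ.box _ _ hψ.2⟩, (hr.1 b ψ hb hψ.1).2, hψ.2⟩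
    · exact ⟨hr.2 b ψ hb hψ.1, hψ.2⟩

/-- A formula of a finite subformula-closed set is unprovable if and only if it is missing from
some type of some saturated set. -/
theorem not_provable_iff {Δ : Set (Formula Λ)} (hfin : Δ.Finite) (hΔ : SubformulaClosed Δ)
    {φ : Formula Λ} (hφ : φ ∈ Δ) :
    ¬ Provable φ ↔ ∃ T, Saturated Δ T ∧ ∃ x ∈ T, φ ∉ x := by
  refine ⟨fun h => ?_, fun ⟨T, hT, x, hx, hn⟩ h => hn (h.mem_of_saturated hfin hΔ hT hφ hx)⟩
  obtain ⟨Γ, hΓ, hn⟩ := exists_world_not_mem h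
  exact ⟨_, saturated_worlds.restrict hΔ, _, ⟨Γ, hΓ, rfl⟩, fun h => hn h.1⟩

end Order

end GLP

/-! ### Computable search through lists -/

section Primrec

variable {α β : Type*}

/-- The list of all sublists of a list. -/
def List.powerList : List α → List (List α) :=
  List.foldr (fun a L => L ++ L.map (a :: ·)) [[]]

theorem List.filter_mem_powerList (p : α → Bool) (l : List α) : l.filter p ∈ l.powerList := by
  induction l with
  | nil => simp [List.powerList]
  | cons a l ih =>
    have h : (a :: l).powerList = l.powerList ++ l.powerList.map (a :: ·) := rfl
    rw [h, List.filter_cons, List.mem_append]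
    split
    · exact Or.inr (List.mem_map_of_mem ih)
    · exact Or.inl ih

theorem List.subset_of_mem_powerList {l l' : List α} (h : l' ∈ l.powerList) : l' ⊆ l := by
  induction l generalizing l' with
  | nil =>
    rw [List.powerList, List.foldr_nil, List.mem_singleton] at h
    exact h ▸ List.Subset.refl _
  | cons a l ih =>
    rcases List.mem_append.1 (show l' ∈ l.powerList ++ l.powerList.map (a :: ·) from h) with h | h
    · exact List.subset_cons_of_subset a (ih h)
    · obtain ⟨m, hm, rfl⟩ := List.mem_map.1 h
      exact List.cons_subset_cons a (ih hm)

variable [Primcodable α] [Primcodable β]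

theorem PrimrecPred.imp {p q : α → Prop} (hp : PrimrecPred p) (hq : PrimrecPred q) :
    PrimrecPred fun a => p a → q a :=
  (hp.not.or hq).of_eq fun _ => imp_iff_not_or.symm

theorem PrimrecPred.iff {p q : α → Prop} (hp : PrimrecPred p) (hq : PrimrecPred q) :
    PrimrecPred fun a => p a ↔ q a :=
  ((hp.imp hq).and (hq.imp hp)).of_eq fun _ => iff_iff_implies_and_implies.symm

theorem PrimrecPred.forall_mem {f : α → List β} {p : α → β → Prop} (hf : Primrec f)
    (hp : PrimrecPred fun q : α × β => p q.1 q.2) : PrimrecPred fun a => ∀ b ∈ f a, p a b :=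
  PrimrecRel.comp (R := fun (L : List β) a => ∀ b ∈ L, p a b)
    (PrimrecRel.forall_mem_list (R := fun b a => p a b)
      (PrimrecPred.comp hp (Primrec.pair Primrec.snd Primrec.fst))) hf Primrec.id

theorem PrimrecPred.exists_mem {f : α → List β} {p : α → β → Prop} (hf : Primrec f)
    (hp : PrimrecPred fun q : α × β => p q.1 q.2) : PrimrecPred fun a => ∃ b ∈ f a, p a b :=
  (PrimrecPred.forall_mem (p := fun a b => ¬ p a b) hf hp.not).not.of_eq fun a => by simp

theorem PrimrecPred.mem {f : α → List β} {g : α → β} (hf : Primrec f) (hg : Primrec g) :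
    PrimrecPred fun a => g a ∈ f a :=
  (PrimrecPred.exists_mem (p := fun a b => b = g a) hf
    (Primrec.eq.comp Primrec.snd (hg.comp Primrec.fst))).of_eq fun a => by simp

theorem Primrec.powerList : Primrec (List.powerList : List α → List (List α)) := by
  refine Primrec.list_foldr (σ := List (List α))
    (h := fun _ q => q.2 ++ q.2.map (q.1 :: ·)) Primrec.id (Primrec.const [[]]) ?_
  have h₂ : Primrec fun p : List α × α × List (List α) => p.2.2 :=
    Primrec.snd.comp Primrec.snd
  have hc : Primrec₂ fun (p : List α × α × List (List α)) (L : List α) => p.2.1 :: L :=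
    Primrec₂.comp Primrec.list_cons (Primrec.fst.comp (Primrec.snd.comp Primrec.fst)) Primrec.snd
  exact Primrec.list_append.comp h₂ (Primrec.list_map h₂ hc)

/-- The predicate is merely computable, so the list is built by recursion on its length. This is how
the order table is obtained. -/
theorem ComputablePred.filter_range {p : ℕ → Prop} [DecidablePred p] (hp : ComputablePred p) :
    Computable fun n => (List.range n).filter fun k => decide (p k) := by
  have hf : Computable fun k => decide (p k) := hp.decide
  have hy : Computable fun q : ℕ × ℕ × List ℕ => q.2.1 := Computable.fst.comp Computable.snd
  have hl : Computable fun q : ℕ × ℕ × List ℕ => q.2.2 := Computable.snd.comp Computable.snd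
  refine (Computable.nat_rec (σ := List ℕ) (h := fun _ q =>
    bif decide (p q.1) then q.2 ++ [q.1] else q.2) Computable.id (Computable.const [])
    (Computable.cond (hf.comp hy) (Computable.list_append.comp hl
      (Computable.list_cons.comp hy (Computable.const []))) hl)).of_eq fun n => ?_
  induction n with
  | zero => rfl
  | succ n ih =>
    rw [List.range_succ, List.filter_append, ← ih]
    by_cases h : p n <;> simp [h]

end Primrec

/-! ### The decision procedure on codes -/

namespace GLP

/-- The accessibility relation on types given as lists of codes in `V`; `t` lists the pairs of
the order relation. -/
def CodeReach (t V : List ℕ) (c : ℕ) (x y : List ℕ) : Prop :=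
  ∀ j ∈ V, j.unpair.1 = 4 →
    (Nat.pair j.unpair.2.unpair.1 c ∈ t → j ∈ x → j.unpair.2.unpair.2 ∈ y ∧ j ∈ y) ∧
      (Nat.pair c j.unpair.2.unpair.1 ∉ t → j ∈ y → j ∈ x)

/-- The list `V` consists of codes of formulas and is closed under codes of subformulas. -/
def CodeClosed (t V : List ℕ) : Prop :=
  ∀ k ∈ V, k.unpair.1 = 0 ∨ k = Nat.pair 1 0 ∨ (k.unpair.1 = 2 ∧ k.unpair.2 ∈ V) ∨
    (k.unpair.1 = 3 ∧ k.unpair.2.unpair.1 ∈ V ∧ k.unpair.2.unpair.2 ∈ V) ∨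
    (k.unpair.1 = 4 ∧ Nat.pair k.unpair.2.unpair.1 k.unpair.2.unpair.1 ∈ t ∧
      k.unpair.2.unpair.2 ∈ V)

/-- The condition of saturation for a list `T` of types given as lists of codes. -/
def CodeSaturated (t V : List ℕ) (T : List (List ℕ)) : Prop :=
  ∀ x ∈ T, ∀ k ∈ V, (k = Nat.pair 1 0 → k ∈ x) ∧
    (k.unpair.1 = 2 → (k ∈ x ↔ k.unpair.2 ∉ x)) ∧
    (k.unpair.1 = 3 → (k ∈ x ↔ k.unpair.2.unpair.1 ∈ x ∧ k.unpair.2.unpair.2 ∈ x)) ∧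
    (k.unpair.1 = 4 → k ∉ x → ∃ y ∈ T, CodeReach t V k.unpair.2.unpair.1 x y ∧ k ∈ y ∧
      k.unpair.2.unpair.2 ∉ y)

/-- The decision procedure, relative to a list `t` of the pairs of the order relation. -/
def CodeProvable (t : List ℕ) (n : ℕ) : Prop :=
  ∃ V ∈ (List.range (n + 1)).powerList, (n ∈ V ∧ CodeClosed t V) ∧
    ¬ ∃ T ∈ V.powerList.powerList, CodeSaturated t V T ∧ ∃ x ∈ T, n ∉ x

section

open Primrec

variable {α : Type*} [Primcodable α]

theorem primrecPred_codeReach {t V x y : α → List ℕ} {c : α → ℕ} (ht : Primrec t)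
    (hV : Primrec V) (hc : Primrec c) (hx : Primrec x) (hy : Primrec y) :
    PrimrecPred fun a => CodeReach (t a) (V a) (c a) (x a) (y a) := by
  refine PrimrecPred.forall_mem hV ?_
  have hj : Primrec fun q : α × ℕ => q.2 := snd
  have hj₁ := fst.comp (unpair.comp hj)
  have hj₂ := unpair.comp (snd.comp (unpair.comp hj))
  have hb := fst.comp hj₂
  have hφ := snd.comp hj₂
  replace ht := ht.comp (fst (α := α) (β := ℕ))
  replace hx := hx.comp (fst (α := α) (β := ℕ))
  replace hy := hy.comp (fst (α := α) (β := ℕ))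
  replace hc := hc.comp (fst (α := α) (β := ℕ))
  exact (Primrec.eq.comp hj₁ (const 4)).imp
    (((PrimrecPred.mem ht (Primrec₂.natPair.comp hb hc)).imp ((PrimrecPred.mem hx hj).imp
      ((PrimrecPred.mem hy hφ).and (PrimrecPred.mem hy hj)))).and
    ((PrimrecPred.mem ht (Primrec₂.natPair.comp hc hb)).not.imp
      ((PrimrecPred.mem hy hj).imp (PrimrecPred.mem hx hj))))

theorem primrecPred_codeClosed {t V : α → List ℕ} (ht : Primrec t) (hV : Primrec V) :
    PrimrecPred fun a => CodeClosed (t a) (V a) := by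
  refine PrimrecPred.forall_mem hV ?_
  have hk : Primrec fun q : α × ℕ => q.2 := snd
  have hk₁ := fst.comp (unpair.comp hk)
  have hk₂ := snd.comp (unpair.comp hk)
  have hl := fst.comp (unpair.comp hk₂)
  have hr := snd.comp (unpair.comp hk₂)
  replace ht := ht.comp (fst (α := α) (β := ℕ))
  replace hV := hV.comp (fst (α := α) (β := ℕ))
  exact (Primrec.eq.comp hk₁ (const 0)).or <| (Primrec.eq.comp hk (const _)).or <|
    ((Primrec.eq.comp hk₁ (const 2)).and (PrimrecPred.mem hV hk₂)).or <|
    ((Primrec.eq.comp hk₁ (const 3)).and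
      ((PrimrecPred.mem hV hl).and (PrimrecPred.mem hV hr))).or <|
    (Primrec.eq.comp hk₁ (const 4)).and
      ((PrimrecPred.mem ht (Primrec₂.natPair.comp hl hl)).and (PrimrecPred.mem hV hr))

theorem primrecPred_codeSaturated {t V : α → List ℕ} {T : α → List (List ℕ)} (ht : Primrec t)
    (hV : Primrec V) (hT : Primrec T) :
    PrimrecPred fun a => CodeSaturated (t a) (V a) (T a) := by
  refine PrimrecPred.forall_mem hT (PrimrecPred.forall_mem (hV.comp fst) ?_)
  have hk : Primrec fun q : (α × List ℕ) × ℕ => q.2 := snd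
  have hx : Primrec fun q : (α × List ℕ) × ℕ => q.1.2 := snd.comp fst
  have ha : Primrec fun q : (α × List ℕ) × ℕ => q.1.1 := fst.comp fst
  have hk₁ := fst.comp (unpair.comp hk)
  have hk₂ := snd.comp (unpair.comp hk)
  have hl := fst.comp (unpair.comp hk₂)
  have hr := snd.comp (unpair.comp hk₂)
  have hf : Primrec (Prod.fst : ((α × List ℕ) × ℕ) × List ℕ → (α × List ℕ) × ℕ) := fst
  refine ((Primrec.eq.comp hk (const _)).imp (PrimrecPred.mem hx hk)).and <|
    ((Primrec.eq.comp hk₁ (const 2)).imp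
      ((PrimrecPred.mem hx hk).iff (PrimrecPred.mem hx hk₂).not)).and <|
    ((Primrec.eq.comp hk₁ (const 3)).imp ((PrimrecPred.mem hx hk).iff
      ((PrimrecPred.mem hx hl).and (PrimrecPred.mem hx hr)))).and <|
    (Primrec.eq.comp hk₁ (const 4)).imp ((PrimrecPred.mem hx hk).not.imp
      (PrimrecPred.exists_mem (hT.comp ha) ?_))
  exact (primrecPred_codeReach ((ht.comp ha).comp hf) ((hV.comp ha).comp hf) (hl.comp hf)
    (hx.comp hf) snd).and ((PrimrecPred.mem snd (hk.comp hf)).and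
      (PrimrecPred.mem snd (hr.comp hf)).not)

theorem primrecPred_codeProvable :
    PrimrecPred fun q : List ℕ × ℕ => CodeProvable q.1 q.2 := by
  refine PrimrecPred.exists_mem (powerList.comp (list_range.comp (succ.comp snd))) ?_
  have hn : Primrec fun q : (List ℕ × ℕ) × List ℕ => q.1.2 := snd.comp fst
  have ht : Primrec fun q : (List ℕ × ℕ) × List ℕ => q.1.1 := fst.comp fst
  have hV : Primrec fun q : (List ℕ × ℕ) × List ℕ => q.2 := snd
  refine ((PrimrecPred.mem hV hn).and (primrecPred_codeClosed ht hV)).and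
    (PrimrecPred.exists_mem (powerList.comp (powerList.comp hV)) ?_).not
  have hf : Primrec (Prod.fst : ((List ℕ × ℕ) × List ℕ) × List (List ℕ) → _) := fst
  exact (primrecPred_codeSaturated (ht.comp hf) (hV.comp hf) snd).and
    (PrimrecPred.exists_mem snd (PrimrecPred.mem snd (hn.comp (fst.comp fst))).not)

end

variable {Λ : Type*} [LinearOrder Λ]

/-- The order relation on names of elements of `Λ`, as a predicate on coded pairs. -/
def CodeLE (c : Λ → ℕ) (k : ℕ) : Prop := ∃ a b, k = Nat.pair (c a) (c b) ∧ a ≤ b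

theorem RecursivePresentation.computable_codeLE (P : RecursivePresentation Λ) :
    ComputablePred (CodeLE P.code) := by
  classical
  have hd := P.computable_domain.decide
  have hl := P.computable_lt.decide
  have hu : Computable Nat.unpair := Primrec.unpair.to_comp
  have h₁ := hd.comp (Computable.fst.comp hu)
  have h₂ := hd.comp (Computable.snd.comp hu)
  have h₃ := hl.comp (Computable.pair (Computable.snd.comp hu) (Computable.fst.comp hu))
  refine ComputablePred.computable_iff.2 ⟨_, Primrec.and.to_comp.comp h₁
    (Primrec.and.to_comp.comp h₂ (Primrec.not.to_comp.comp h₃)), funext fun k => propext ?_⟩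
  simp only [Bool.and_eq_true, decide_eq_true_eq, Bool.not_eq_true', decide_eq_false_iff_not]
  constructor
  · rintro ⟨a, b, rfl, hab⟩
    simp only [Nat.unpair_pair]
    refine ⟨⟨a, rfl⟩, ⟨b, rfl⟩, ?_⟩
    rintro ⟨b', a', hb, ha, hlt⟩
    rw [P.code_injective hb, P.code_injective ha] at hlt
    exact hlt.not_ge hab
  · rintro ⟨⟨a, ha⟩, ⟨b, hb⟩, hn⟩
    exact ⟨a, b, by rw [ha, hb, Nat.pair_unpair],
      not_lt.1 fun h => hn ⟨b, a, hb, ha, h⟩⟩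

end GLP

/-! ### Correctness of the decision procedure -/

namespace GLP

section

variable {Λ : Type*} {c : Λ → ℕ} {t V : List ℕ}

/-- The set of formulas with codes in `V`. -/
def decoded (c : Λ → ℕ) (V : List ℕ) : Set (Formula Λ) := {φ | φ.godelNumber c ∈ V}

theorem mem_decoded {φ : Formula Λ} : φ ∈ decoded c V ↔ φ.godelNumber c ∈ V := Iff.rfl

theorem finite_decoded (hc : Function.Injective c) (V : List ℕ) : (decoded c V).Finite :=
  Set.Finite.preimage (f := Formula.godelNumber c) (Formula.godelNumber_injective hc).injOn
    V.finite_toSet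

theorem CodeClosed.subformulaClosed (h : CodeClosed t V) : SubformulaClosed (decoded c V) where
  neg φ hφ := by
    have := h _ hφ
    simpa [mem_decoded, Formula.godelNumber, Nat.pair_eq_pair] using this
  and φ ψ hφ := by
    have := h _ hφ
    simpa [mem_decoded, Formula.godelNumber, Nat.pair_eq_pair] using this
  box a φ hφ := by
    have := h _ hφ
    simp [Formula.godelNumber, Nat.pair_eq_pair] at this
    exact this.2

theorem le_of_godelNumber_box_le {n : ℕ} {a : Λ} {φ : Formula Λ}
    (h : (Formula.box a φ).godelNumber c ≤ n) : c a ≤ n :=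
  ((Nat.left_le_pair _ _).trans (Nat.right_le_pair _ _)).trans h

theorem lt_pair_of_two_le {m k : ℕ} (hm : 2 ≤ m) : k < Nat.pair m k := by
  rcases lt_or_ge m k with h | h
  · rw [Nat.pair, if_pos h]; nlinarith
  · rw [Nat.pair, if_neg h.not_gt]; nlinarith

open Classical in
/-- The list of the codes in `V` of members of the type `x`. -/
noncomputable def encoded (c : Λ → ℕ) (V : List ℕ) (x : Set (Formula Λ)) : List ℕ :=
  V.filter fun k => ∃ φ ∈ x, φ.godelNumber c = k

theorem godelNumber_mem_encoded (hc : Function.Injective c) {x : Set (Formula Λ)} {φ : Formula Λ}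
    (hφ : φ ∈ decoded c V) : φ.godelNumber c ∈ encoded c V x ↔ φ ∈ x := by
  simp only [encoded, List.mem_filter, decide_eq_true_eq]
  refine ⟨fun ⟨_, ψ, hψ, e⟩ => Formula.godelNumber_injective hc e ▸ hψ,
    fun h => ⟨hφ, φ, h, rfl⟩⟩

section Order

variable [LinearOrder Λ]

theorem CodeClosed.exists_godelNumber_eq (h : CodeClosed t V) (ht : ∀ k ∈ t, CodeLE c k) (k : ℕ)
    (hk : k ∈ V) : ∃ φ : Formula Λ, φ.godelNumber c = k := by
  induction k using Nat.strong_induction_on with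
  | _ k ih =>
    have hlt : ∀ m ≥ 2, k.unpair.1 = m → k.unpair.2 < k := fun m hm e => by
      conv_rhs => rw [← Nat.pair_unpair k, e]
      exact lt_pair_of_two_le hm
    rcases h k hk with h₀ | h₁ | ⟨h₂, hV⟩ | ⟨h₃, hV₁, hV₂⟩ | ⟨h₄, hd, hV⟩
    · exact ⟨.var k.unpair.2, by rw [Formula.godelNumber, ← h₀, Nat.pair_unpair]⟩
    · exact ⟨.top, h₁.symm⟩
    · obtain ⟨φ, hφ⟩ := ih _ (hlt 2 le_rfl h₂) hV
      exact ⟨.neg φ, by rw [Formula.godelNumber, hφ, ← h₂, Nat.pair_unpair]⟩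
    · have hk₂ := hlt 3 (by omega) h₃
      obtain ⟨φ, hφ⟩ := ih _ ((Nat.unpair_left_le _).trans_lt hk₂) hV₁
      obtain ⟨ψ, hψ⟩ := ih _ ((Nat.unpair_right_le _).trans_lt hk₂) hV₂
      exact ⟨.and φ ψ, by
        rw [Formula.godelNumber, hφ, hψ, ← h₃, Nat.pair_unpair, Nat.pair_unpair]⟩
    · obtain ⟨φ, hφ⟩ := ih _ ((Nat.unpair_right_le _).trans_lt (hlt 4 (by omega) h₄)) hV
      -- The diagonal pair in the table certifies that the label of the box names an element of `Λ`.
      obtain ⟨a, b, hab, -⟩ := ht _ hd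
      refine ⟨.box a φ, ?_⟩
      rw [Formula.godelNumber, hφ, ← (Nat.pair_eq_pair.1 hab).1, ← h₄, Nat.pair_unpair,
        Nat.pair_unpair]

/-- The list `t` determines the order relation on elements of `Λ` with names up to `n`. -/
def OrderTable (c : Λ → ℕ) (n : ℕ) (t : List ℕ) : Prop :=
  (∀ k ∈ t, CodeLE c k) ∧ ∀ a b, c a ≤ n → c b ≤ n → a ≤ b → Nat.pair (c a) (c b) ∈ t

theorem OrderTable.le_of_mem {n : ℕ} (ht : OrderTable c n t) (hc : Function.Injective c) {a b : Λ}
    (h : Nat.pair (c a) (c b) ∈ t) : a ≤ b := by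
  obtain ⟨a', b', e, hab⟩ := ht.1 _ h
  rw [Nat.pair_eq_pair] at e
  rwa [hc e.1, hc e.2]

theorem CodeSaturated.saturated {n : ℕ} (ht : OrderTable c n t) (hc : Function.Injective c)
    (hn : ∀ k ∈ V, k ≤ n) (hV : SubformulaClosed (decoded c V)) {T : List (List ℕ)}
    (hT : CodeSaturated t V T) :
    Saturated (decoded c V) ((fun x => decoded c x ∩ decoded c V) '' {x | x ∈ T}) where
  subset := by rintro _ ⟨x, -, rfl⟩; exact Set.inter_subset_right
  top := by
    rintro _ ⟨x, hx, rfl⟩ h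
    exact ⟨(hT x hx _ h).1 rfl, h⟩
  neg := by
    rintro _ ⟨x, hx, rfl⟩ φ h
    have := (hT x hx _ h).2.1
    simp only [Formula.godelNumber, Nat.unpair_pair, forall_const] at this
    simpa only [Set.mem_inter_iff, h, hV.neg _ h, and_true, mem_decoded,
      Formula.godelNumber] using this
  and := by
    rintro _ ⟨x, hx, rfl⟩ φ ψ h
    have := (hT x hx _ h).2.2.1
    simp only [Formula.godelNumber, Nat.unpair_pair, forall_const] at this
    simpa only [Set.mem_inter_iff, h, hV.and _ _ h, and_true, mem_decoded,
      Formula.godelNumber] using this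
  box := by
    rintro _ ⟨x, hx, rfl⟩ a φ h hn'
    have := (hT x hx _ h).2.2.2
    simp only [Formula.godelNumber, Nat.unpair_pair, forall_const] at this
    obtain ⟨y, hy, hr, h₁, h₂⟩ := this fun h' => hn' ⟨h', h⟩
    have ha := le_of_godelNumber_box_le (hn _ h)
    refine ⟨_, ⟨y, hy, rfl⟩, ⟨fun b ψ hb hψ => ?_, fun b ψ hb hψ => ?_⟩, ⟨h₁, h⟩,
      fun h' => h₂ h'.1⟩
    · obtain ⟨h₃, h₄⟩ := (hr _ hψ.2 (by simp [Formula.godelNumber])).1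
        (by simpa [Formula.godelNumber] using
          ht.2 b a (le_of_godelNumber_box_le (hn _ hψ.2)) ha hb) hψ.1
      simp only [Formula.godelNumber, Nat.unpair_pair] at h₃
      exact ⟨⟨h₃, hV.box _ _ hψ.2⟩, h₄, hψ.2⟩
    · refine ⟨(hr _ hψ.2 (by simp [Formula.godelNumber])).2 (fun h' => ?_) hψ.1, hψ.2⟩
      simp only [Formula.godelNumber, Nat.unpair_pair] at h'
      exact hb.not_ge (ht.le_of_mem hc h')

theorem Saturated.codeSaturated {n : ℕ} (ht : OrderTable c n t) (hc : Function.Injective c)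
    (hn : ∀ k ∈ V, k ≤ n) (hV : CodeClosed t V) {S : Set (Set (Formula Λ))}
    (hS : Saturated (decoded c V) S) {T : List (List ℕ)}
    (hT : ∀ l, l ∈ T ↔ ∃ x ∈ S, encoded c V x = l) : CodeSaturated t V T := by
  have hΔ : SubformulaClosed (decoded c V) := hV.subformulaClosed
  intro l hl k hk
  obtain ⟨x, hx, rfl⟩ := (hT l).1 hl
  obtain ⟨φ, rfl⟩ := hV.exists_godelNumber_eq ht.1 k hk
  have hmem := fun x => godelNumber_mem_encoded (x := x) hc (φ := φ) hk
  rw [hmem]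
  cases φ with
  | var m => simp [Formula.godelNumber, Nat.pair_eq_pair]
  | top => simpa [Formula.godelNumber] using hS.top x hx hk
  | neg φ =>
    simpa [Formula.godelNumber, Nat.pair_eq_pair,
      godelNumber_mem_encoded hc (hΔ.neg _ hk)] using hS.neg x hx φ hk
  | and φ ψ =>
    simpa [Formula.godelNumber, Nat.pair_eq_pair, godelNumber_mem_encoded hc (hΔ.and _ _ hk).1,
      godelNumber_mem_encoded hc (hΔ.and _ _ hk).2] using hS.and x hx φ ψ hk
  | box a φ =>
    refine ⟨by simp [Formula.godelNumber, Nat.pair_eq_pair], by simp [Formula.godelNumber],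
      by simp [Formula.godelNumber], fun _ h => ?_⟩
    obtain ⟨y, hy, hr, h₁, h₂⟩ := hS.box x hx a φ hk h
    refine ⟨_, (hT _).2 ⟨y, hy, rfl⟩, ?_, (hmem y).2 h₁, ?_⟩
    · intro j hj hj₄
      obtain ⟨ψ, rfl⟩ := hV.exists_godelNumber_eq ht.1 j hj
      have ha := le_of_godelNumber_box_le (hn _ hk)
      cases ψ with
      | box b ψ =>
        have hb := le_of_godelNumber_box_le (hn _ hj)
        rw [godelNumber_mem_encoded hc hj, godelNumber_mem_encoded hc hj]
        simp only [Formula.godelNumber, Nat.unpair_pair]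
        rw [godelNumber_mem_encoded hc (hΔ.box _ _ hj)]
        -- The table lists the pairs of `≤`; by linearity, absence of the pair for `a ≤ b` means `b
        -- < a`. Both names are at most `n`, where the table is complete.
        exact ⟨fun h => hr.1 b ψ (ht.le_of_mem hc h), fun h =>
          hr.2 b ψ (not_le.1 fun h' => h (ht.2 a b ha hb h'))⟩
      | _ => simp [Formula.godelNumber] at hj₄
    · simp only [Formula.godelNumber, Nat.unpair_pair]
      rwa [godelNumber_mem_encoded hc (hΔ.box _ _ hk)]

theorem CodeClosed.exists_codeSaturated_iff {n : ℕ} (ht : OrderTable c n t)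
    (hc : Function.Injective c) (hn : ∀ k ∈ V, k ≤ n) (hV : CodeClosed t V) {φ : Formula Λ}
    (hφ : φ ∈ decoded c V) :
    (∃ T ∈ V.powerList.powerList, CodeSaturated t V T ∧ ∃ x ∈ T, φ.godelNumber c ∉ x) ↔
      ¬ Provable φ := by
  classical
  have hΔ : SubformulaClosed (decoded c V) := hV.subformulaClosed
  rw [not_provable_iff (finite_decoded hc V) hΔ hφ]
  constructor
  · rintro ⟨T, -, hT, x, hx, hn'⟩
    exact ⟨_, hT.saturated ht hc hn hΔ, _, ⟨x, hx, rfl⟩, fun h => hn' h.1⟩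
  · rintro ⟨S, hS, x, hx, hn'⟩
    -- Encoded types are filters of `V`, so the possibly infinite description of `S` turns into a
    -- list within the search space.
    have hT : ∀ l, l ∈ V.powerList.filter (fun l => ∃ x ∈ S, encoded c V x = l) ↔
        ∃ x ∈ S, encoded c V x = l := by
      intro l
      simp only [List.mem_filter, decide_eq_true_eq, and_iff_right_iff_imp]
      rintro ⟨x, -, rfl⟩
      exact List.filter_mem_powerList _ _
    exact ⟨_, List.filter_mem_powerList _ _, hS.codeSaturated ht hc hn hV hT, _,
      (hT _).2 ⟨x, hx, rfl⟩, fun h => hn' ((godelNumber_mem_encoded hc hφ).1 h)⟩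

/-- The Gödel numbers up to `n` form a closed list. -/
theorem exists_codeClosed {n : ℕ} (ht : OrderTable c n t) :
    ∃ V ∈ (List.range (n + 1)).powerList, CodeClosed t V ∧
      ∀ φ : Formula Λ, φ.godelNumber c ≤ n → φ.godelNumber c ∈ V := by
  classical
  have hmem : ∀ k, k ∈ (List.range (n + 1)).filter (fun k => ∃ φ : Formula Λ, φ.godelNumber c = k) ↔
      k ≤ n ∧ ∃ φ : Formula Λ, φ.godelNumber c = k := by
    intro k
    simp
  refine ⟨_, List.filter_mem_powerList _ _, fun k hk => ?_, fun φ hφ => (hmem _).2 ⟨hφ, φ, rfl⟩⟩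
  obtain ⟨hkn, φ, rfl⟩ := (hmem k).1 hk
  cases φ with
  | var m => exact Or.inl (by simp [Formula.godelNumber])
  | top => exact Or.inr (Or.inl rfl)
  | neg φ =>
    refine Or.inr (Or.inr (Or.inl ⟨by simp [Formula.godelNumber], ?_⟩))
    simp only [Formula.godelNumber, Nat.unpair_pair] at hkn ⊢
    exact (hmem _).2 ⟨(Nat.right_le_pair _ _).trans hkn, φ, rfl⟩
  | and φ ψ =>
    refine Or.inr (Or.inr (Or.inr (Or.inl ⟨by simp [Formula.godelNumber], ?_⟩)))
    simp only [Formula.godelNumber, Nat.unpair_pair] at hkn ⊢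
    have h := (Nat.right_le_pair _ _).trans hkn
    exact ⟨(hmem _).2 ⟨(Nat.left_le_pair _ _).trans h, φ, rfl⟩,
      (hmem _).2 ⟨(Nat.right_le_pair _ _).trans h, ψ, rfl⟩⟩
  | box a φ =>
    have ha := le_of_godelNumber_box_le hkn
    refine Or.inr (Or.inr (Or.inr (Or.inr ⟨by simp [Formula.godelNumber], ?_⟩)))
    simp only [Formula.godelNumber, Nat.unpair_pair] at hkn ⊢
    have h := (Nat.right_le_pair _ _).trans hkn
    exact ⟨ht.2 a a ha ha le_rfl, (hmem _).2 ⟨(Nat.right_le_pair _ _).trans h, φ, rfl⟩⟩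

theorem codeProvable_iff {n : ℕ} (ht : OrderTable c n t) (hc : Function.Injective c) :
    CodeProvable t n ↔ ∃ φ : Formula Λ, Provable φ ∧ φ.godelNumber c = n := by
  have hle : ∀ V ∈ (List.range (n + 1)).powerList, ∀ k ∈ V, k ≤ n := fun V hV k hk =>
    Nat.lt_succ_iff.1 (List.mem_range.1 (List.subset_of_mem_powerList hV hk))
  constructor
  · rintro ⟨V, hV, ⟨hn, hcl⟩, h⟩
    obtain ⟨φ, rfl⟩ := hcl.exists_godelNumber_eq ht.1 n hn
    rw [hcl.exists_codeSaturated_iff ht hc (hle V hV) hn, not_not] at h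
    exact ⟨φ, h, rfl⟩
  · rintro ⟨φ, hφ, rfl⟩
    obtain ⟨V, hV, hcl, hmem⟩ := exists_codeClosed ht
    have hn := hmem φ le_rfl
    exact ⟨V, hV, ⟨hn, hcl⟩, fun h =>
      (hcl.exists_codeSaturated_iff ht hc (hle V hV) hn).1 h hφ⟩

open Classical in
theorem orderTable_filter_range (c : Λ → ℕ) (n : ℕ) :
    OrderTable c n ((List.range ((n + 1) * (n + 1))).filter fun k => CodeLE c k) := by
  refine ⟨fun k hk => by simpa using (List.mem_filter.1 hk).2, fun a b ha hb hab => ?_⟩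
  refine List.mem_filter.2 ⟨List.mem_range.2 ?_, by simpa using ⟨a, b, rfl, hab⟩⟩
  -- The pairing maps pairs with entries at most `n` below `(n + 1)²`, which is the length of the
  -- range searched.
  calc Nat.pair (c a) (c b) < (max (c a) (c b) + 1) ^ 2 := Nat.pair_lt_max_add_one_sq _ _
    _ ≤ (n + 1) * (n + 1) := by
      rw [sq]
      exact Nat.mul_le_mul (Nat.succ_le_succ (max_le ha hb)) (Nat.succ_le_succ (max_le ha hb))

end Order

end

end GLP

theorem mainTheorem11 {Λ : Type*} [LinearOrder Λ] (P : GLP.RecursivePresentation Λ) :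
    ComputablePred fun n : ℕ =>
      ∃ φ : GLP.Formula Λ, GLP.Provable φ ∧ φ.godelNumber P.code = n := by
  classical
  have hb : Computable fun n : ℕ => (n + 1) * (n + 1) :=
    (Primrec.nat_mul.comp Primrec.succ Primrec.succ).to_comp
  have ht := P.computable_codeLE.filter_range.comp hb
  have h : Computable fun n : ℕ => decide (GLP.CodeProvable _ n) :=
    GLP.primrecPred_codeProvable.decide.to_comp.comp (ht.pair Computable.id)
  exact ComputablePred.of_eq ⟨_, h⟩ fun n =>
    GLP.codeProvable_iff (GLP.orderTable_filter_range P.code n) P.code_injective
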